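/- Let $A$ be a unital C$^*$-algebra and $D=\{z\in A:\|z\|<1\}$. On the right $A$-module $A^2$ let $\theta(x,y)=x_1^*y_1-x_2^*y_2$, and let $U(\theta)\subset GL_2(A)$ be the group of invertible matrices preserving $\theta$; it acts on $D$ by $g\cdot z=(g_{21}+g_{22}z)(g_{11}+g_{12}z)^{-1}$. For $z\in D$ let $\ell_z=\{(1,z)a:a\in A\}\subset A^2$, let $q_z\in M_2(A)$ be the $\theta$-orthogonal projection onto $\ell_z$, $q_z(y)=(1,z)(1-z^*z)^{-1}\theta((1,z),y)$, and let $\varepsilon_z=2q_z-1$ be the corresponding reflection. A *normalized basis* of $\ell_z$ is an $x\in\ell_z$ with $\theta(x,x)=1$ and $x_1$ invertible. Let $\Gamma_z$ be the algebra of right $A$-module endomorphisms of $\ell_z$, with the C$^*$-structure obtained from $A$ by identifying $\varphi\in\Gamma_z$ with its matrix $a$, $\varphi(x)=xa$, in a normalized basis $x$ (another normalized basis $xu$, $u$ unitary, replaces $a$ by $u^*au$). For a matrix $V$ tangent at $q_z$ to $\{q_w : w\in D\}$, or at $\varepsilon_z$ to $\{\varepsilon_w : w\in D\}$, let $\langle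 V,V\rangle_z\in\Gamma_z$ be the endomorphism with matrix $-\theta(Vx,Vx)$, let $\mathrm{mod}_z(V)=\langle V,V\rangle_z^{1/2}$ be the *$\theta$-modulus* of $V$, and let $\|V\|_z=\|\theta(Vx,Vx)\|^{1/2}$. The geodesics from $z_0\in D$ are the curves $\delta(t)=e^{tX}\cdot z_0$, where $X\in M_2(A)$ is $\theta$-antisymmetric and co-diagonal with respect to $q_{z_0}$ (that is, $q_{z_0}Xq_{z_0}=0=(1-q_{z_0})X(1-q_{z_0})$). Define $cr(0,z)\in\Gamma_z$ by $cr(0,z)\big((1,z)a\big)=(1,z)(1+|z|)(1-|z|)^{-1}a$, and for $z_0\ne z_1$ in $D$ put $cr(z_0,z_1)=g\,cr(0,g^{-1}\cdot z_1)\,g^{-1}\in\Gamma_{z_1}$ for any $g\in U(\theta)$ with $g\cdot 0=z_0$. **Theorem.** Let $z_0\neq z_1$ in $D$. There is exactly one such $X$ with $e^{X}\cdot z_0=z_1$; the endomorphism $cr(z_0,z_1)$ exists and does not depend on the choice of $g$; its parallel transport $cr(z_0,z_1)_{z_0}=e^{-X}cr(z_0,z_1)e^{X}$ is a well defined endomorphism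 of $\ell_{z_0}$; and $\ell_{z_0}$ has a normalized basis. Let $\mathrm{Log}_{z_0}(z_1)$ be the initial velocity at $t=0$ of the geodesic $\delta(t)=e^{tX}\cdot z_0$ from $z_0$ to $z_1$, regarded as the matrix $\frac{d}{dt}\big|_{0}\,q_{\delta(t)}$. Then $\langle\mathrm{Log}_{z_0}(z_1),\mathrm{Log}_{z_0}(z_1)\rangle_{z_0}$ is positive, $cr(z_0,z_1)_{z_0}$ is positive and invertible in $\Gamma_{z_0}$, and, for every normalized basis of $\ell_{z_0}$, $$\mathrm{mod}_{z_0}\big(\mathrm{Log}_{z_0}(z_1)\big)=\tfrac12\log\big(cr(z_0,z_1)_{z_0}\big),\qquad \|\mathrm{Log}_{z_0}(z_1)\|_{z_0}=\tfrac12\big\|\log\big(cr(z_0,z_1)_{z_0}\big)\big\|.$$ Equivalently, if the same tangent vector is represented in the model of reflections, by the matrix $\frac{d}{dt}\big|_{0}\,\varepsilon_{\delta(t)}$, the two formulas hold without the factors $\frac12$. -/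

import Mathlib

namespace PoincareDisk

/-- The right `A`-module `A²`; the scalar `a` acts on the right, as `MulOpposite.op a`. -/
abbrev Vec (A : Type*) := Fin 2 → A

/-- The algebra `M₂(A)`, acting on `A²` from the left through `Matrix.mulVec`. -/
abbrev Mat (A : Type*) := Matrix (Fin 2) (Fin 2) A

/-- The open unit disk of `A`. -/
def disk (A : Type*) [CStarAlgebra A] : Set A := {z | ‖z‖ < 1}

/-- The signed form `θ(x, y) = x₁* y₁ - x₂* y₂`. -/
def theta {A : Type*} [CStarAlgebra A] (x y : Vec A) : A :=
  star (x 0) * y 0 - star (x 1) * y 1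

/-- Membership in the group `U(θ)` of invertible matrices that preserve `θ`. -/
def IsThetaUnitary {A : Type*} [CStarAlgebra A] (g : (Mat A)ˣ) : Prop :=
  ∀ x y : Vec A, theta ((g : Mat A).mulVec x) ((g : Mat A).mulVec y) = theta x y

/-- The action on the disk, `g · z = (g₂₁ + g₂₂ z)(g₁₁ + g₁₂ z)⁻¹`. -/
noncomputable def act {A : Type*} [CStarAlgebra A] (g : Mat A) (z : A) : A :=
  (g 1 0 + g 1 1 * z) * Ring.inverse (g 0 0 + g 0 1 * z)

/-- The point `ℓ_z = [(1, z)] = {(1, z) a : a ∈ A}` of the projective line. -/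
def line {A : Type*} [CStarAlgebra A] (z : A) : Submodule Aᵐᵒᵖ (Vec A) :=
  Submodule.span Aᵐᵒᵖ {![1, z]}

/-- The `θ`-orthogonal projection `q_z` onto `ℓ_z`, namely
`y ↦ (1, z) (1 - z* z)⁻¹ θ((1, z), y)`. -/
noncomputable def proj {A : Type*} [CStarAlgebra A] (z : A) : Mat A :=
  !![Ring.inverse (1 - star z * z), -(Ring.inverse (1 - star z * z) * star z);
     z * Ring.inverse (1 - star z * z), -(z * Ring.inverse (1 - star z * z) * star z)]

/-- The reflection `ε_z = 2 q_z - 1` that corresponds to the projection `q_z`. -/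
noncomputable def refl {A : Type*} [CStarAlgebra A] (z : A) : Mat A :=
  2 * proj z - 1

/-- The horizontal space at `z` of the reductive structure of the homogeneous space
`D ≃ U(θ) / (isotropy group)`: the elements of the Lie algebra of `U(θ)` (the
`θ`-antisymmetric matrices) that are co-diagonal with respect to `q_z`.
At `z = 0` these are the matrices with rows `(0, α*)` and `(α, 0)`. -/
def IsHorizontal {A : Type*} [CStarAlgebra A] (z : A) (X : Mat A) : Prop :=
  (∀ x y : Vec A, theta (X.mulVec x) y + theta x (X.mulVec y) = 0) ∧
    proj z * X * proj z = 0 ∧ (1 - proj z) * X * (1 - proj z) = 0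

/-- The geodesic `t ↦ exp(t X) · z` of the reductive connection. -/
noncomputable def geodesic {A : Type*} [CStarAlgebra A] (z : A) (X : Mat A) (t : ℝ) : A :=
  act (NormedSpace.exp (t • X)) z

/-- `X` is horizontal at `z₀`, and the geodesic from `z₀` that it determines is at `z₁` at
time `1`. -/
def Joins {A : Type*} [CStarAlgebra A] (z₀ z₁ : A) (X : Mat A) : Prop :=
  IsHorizontal z₀ X ∧ geodesic z₀ X 1 = z₁

/-- The endomorphism `cr(0, z)` of `ℓ_z`: `(1, z) a ↦ (1, z) (1 + |z|)(1 - |z|)⁻¹ a`.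
The coordinate `a` of the vector `y = (1, z) a` is `y 0`. -/
noncomputable def crZero {A : Type*} [CStarAlgebra A] [PartialOrder A] [StarOrderedRing A]
    (z : A) : Module.End Aᵐᵒᵖ (line z) where
  toFun y := ⟨MulOpposite.op
      ((1 + CFC.abs z) * Ring.inverse (1 - CFC.abs z) * (y : Vec A) 0) • ![1, z],
    Submodule.smul_mem _ _ (Submodule.subset_span rfl)⟩
  map_add' y y' := by
    ext1
    simp only [Submodule.coe_add, Pi.add_apply, mul_add, MulOpposite.op_add, add_smul]
  map_smul' b y := by
    ext1
    simp only [RingHom.id_apply, Submodule.coe_smul, Pi.smul_apply, smul_smul]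
    congr 1
    apply MulOpposite.unop_injective
    simp [mul_assoc]

/-- `φ` is the cross ratio `cr(z₀, z₁) = g cr(0, z) g⁻¹`, an endomorphism of `ℓ_{z₁}`,
where `g ∈ U(θ)`, `g · 0 = z₀` and `z = g⁻¹ · z₁`. -/
def IsCrossRatio {A : Type*} [CStarAlgebra A] [PartialOrder A] [StarOrderedRing A]
    (z₀ z₁ : A) (φ : Module.End Aᵐᵒᵖ (line z₁)) : Prop :=
  ∃ g : (Mat A)ˣ, IsThetaUnitary g ∧ act (g : Mat A) 0 = z₀ ∧
    ∀ y : line (act ((g⁻¹ : (Mat A)ˣ) : Mat A) z₁), ∃ y₁ : line z₁,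
      (y₁ : Vec A) = (g : Mat A).mulVec y ∧
      (φ y₁ : Vec A) = (g : Mat A).mulVec (crZero _ y)

/-- `ψ = e^{-X} φ e^{X}` is the parallel transport to `ℓ_{z₀}` of the endomorphism `φ` of
`ℓ_{z₁}`, along the geodesic `t ↦ exp(t X) · z₀`. -/
def IsTransport {A : Type*} [CStarAlgebra A] {z₀ z₁ : A} (X : Mat A)
    (φ : Module.End Aᵐᵒᵖ (line z₁)) (ψ : Module.End Aᵐᵒᵖ (line z₀)) : Prop :=
  ∀ y : line z₀, ∃ y₁ : line z₁,
    (y₁ : Vec A) = (NormedSpace.exp X).mulVec y ∧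
    (φ y₁ : Vec A) = (NormedSpace.exp X).mulVec (ψ y)

/-- `x` is a normalized basis of `ℓ_z`: an element of `ℓ_z` in the hyperboloid `K_θ`, i.e.
`θ(x, x) = 1` and `x₁` is invertible. -/
def IsNormalized {A : Type*} [CStarAlgebra A] {z : A} (x : line z) : Prop :=
  theta (x : Vec A) x = 1 ∧ IsUnit ((x : Vec A) 0)

/-- The matrix `a` of an endomorphism `φ` of `ℓ_z` in a normalized basis `x`: since
`θ(x, x) = 1`, the equality `φ x = x a` gives `a = θ(x, φ x)`. -/
def matrixOf {A : Type*} [CStarAlgebra A] {z : A} (x : line z)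
    (φ : Module.End Aᵐᵒᵖ (line z)) : A :=
  theta (x : Vec A) (φ x)

/-- The endomorphism of `ℓ_z` with matrix `a` in the normalized basis `x`: it maps
`y = x λ`, where `λ = θ(x, y)`, to `x a λ`. -/
def endOf {A : Type*} [CStarAlgebra A] {z : A} (x : line z) (a : A) :
    Module.End Aᵐᵒᵖ (line z) where
  toFun y := MulOpposite.op (a * theta (x : Vec A) y) • x
  map_add' y y' := by
    rw [← add_smul, ← MulOpposite.op_add, ← mul_add]
    congr 3
    simp only [theta, Submodule.coe_add, Pi.add_apply]
    noncomm_ring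
  map_smul' b y := by
    rw [RingHom.id_apply, smul_smul]
    congr 1
    apply MulOpposite.unop_injective
    simp [theta, mul_assoc, sub_mul]

/-! The fibre `Γ_z` of the coefficient bundle is the algebra of endomorphisms of `ℓ_z`, with the
C*-structure that it receives from `A` through the matrix in a normalized basis `x`. -/

/-- The logarithm in `Γ_z`. -/
noncomputable def logEnd {A : Type*} [CStarAlgebra A] {z : A} (x : line z)
    (φ : Module.End Aᵐᵒᵖ (line z)) : Module.End Aᵐᵒᵖ (line z) :=
  endOf x (CFC.log (matrixOf x φ))

/-- The positive square root in `Γ_z`. -/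
noncomputable def sqrtEnd {A : Type*} [CStarAlgebra A] [PartialOrder A] [StarOrderedRing A]
    {z : A} (x : line z) (φ : Module.End Aᵐᵒᵖ (line z)) : Module.End Aᵐᵒᵖ (line z) :=
  endOf x (CFC.sqrt (matrixOf x φ))

/-- The norm of `Γ_z`. -/
noncomputable def normEnd {A : Type*} [CStarAlgebra A] {z : A} (x : line z)
    (φ : Module.End Aᵐᵒᵖ (line z)) : ℝ :=
  ‖matrixOf x φ‖

/-- The `Γ_z`-valued product `⟨V, W⟩_z` of tangent matrices, with matrix `-θ(V x, W x)` in the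
normalized basis `x`. -/
def innerEnd {A : Type*} [CStarAlgebra A] {z : A} (x : line z) (V W : Mat A) :
    Module.End Aᵐᵒᵖ (line z) :=
  endOf x (-theta (V.mulVec x) (W.mulVec x))

/-- The `θ`-modulus `⟨V, V⟩_z^{1/2}`. -/
noncomputable def modulus {A : Type*} [CStarAlgebra A] [PartialOrder A] [StarOrderedRing A]
    {z : A} (x : line z) (V : Mat A) : Module.End Aᵐᵒᵖ (line z) :=
  sqrtEnd x (innerEnd x V V)

/-- The Finsler norm `‖θ(V x, V x)‖^{1/2}` of a tangent matrix at `z`, for a normalized basis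
`x` of `ℓ_z`. -/
noncomputable def finslerNorm {A : Type*} [CStarAlgebra A] {z : A} (x : line z) (V : Mat A) : ℝ :=
  Real.sqrt ‖theta (V.mulVec x) (V.mulVec x)‖

end PoincareDisk

/-! The group `U(θ)` acts transitively on the disk and carries geodesics, cross ratios and
transports to one another, so everything reduces to `z₀ = 0`. There a horizontal matrix is
`X = [0, α*; α, 0]` and `X² (1, 0) = (1, 0) α* α`, so `e^X (1, 0) = (cosh |α|, α sinh |α| / |α|)`
and `e^X · 0 = v tanh |α|` for the polar decomposition `α = v |α|`. This is a bijection from `A`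
onto the disk, because the Cayley transform `(1 + r)(1 - r)⁻¹` of `r = tanh |α|` is `exp (2 |α|)`,
from which the logarithm recovers `|α|`. The same identity says that the cross ratio of `0` and
`e^X · 0` has matrix `exp (2 |α|)`, while the velocity of the geodesic maps `(1, 0)` to `(0, α)`
and has `θ`-modulus `|α|`. The tangent vector of the reflections is twice that of the projections,
which removes the factor `1 / 2`. -/

namespace PoincareDisk

open NormedSpace
open scoped Matrix

section Algebra

theorem commute_ringInverse {M : Type*} [MonoidWithZero M] {a b : M} (h : Commute a b) :
    Commute a (Ring.inverse b) := by
  by_cases hb : IsUnit b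
  · obtain ⟨u, rfl⟩ := hb
    rw [Ring.inverse_unit]
    exact h.units_inv_right
  · rw [Ring.inverse_non_unit _ hb]
    exact Commute.zero_right a

theorem isUnit_of_isUnit_star_mul_self {M : Type*} [Monoid M] [StarMul M] {a : M}
    (h : IsUnit (star a * a)) (h' : IsUnit (a * star a)) : IsUnit a := by
  obtain ⟨b, hb⟩ := h'.exists_right_inv
  obtain ⟨c, hc⟩ := h.exists_left_inv
  exact isUnit_iff_exists_and_exists.2
    ⟨⟨star a * b, by rw [← mul_assoc, hb]⟩, ⟨c * star a, by rw [mul_assoc, hc]⟩⟩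

variable {R : Type*} [Ring R]

/-- The Cayley transform `r ↦ (1 + r)(1 - r)⁻¹`, which turns `|z|` into the cross ratio of `0`
and `z`; it is only meaningful where `1 - r` is invertible, as `Ring.inverse` is `0` elsewhere. -/
noncomputable def cayley (r : R) : R := (1 + r) * Ring.inverse (1 - r)

theorem cayley_add_one {r : R} (hr : IsUnit (1 - r)) :
    cayley r + 1 = Ring.inverse (1 - r) + Ring.inverse (1 - r) := by
  calc cayley r + 1 = (1 + r) * Ring.inverse (1 - r) + (1 - r) * Ring.inverse (1 - r) := by
        rw [cayley, Ring.mul_inverse_cancel _ hr]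
    _ = Ring.inverse (1 - r) + Ring.inverse (1 - r) := by noncomm_ring

theorem cayley_injOn (h2 : IsUnit (2 : R)) : Set.InjOn (cayley (R := R)) {r | IsUnit (1 - r)} := by
  intro r (hr : IsUnit (1 - r)) s (hs : IsUnit (1 - s)) h
  have hinv : Ring.inverse (1 - r) = Ring.inverse (1 - s) := by
    refine h2.mul_right_injective ?_
    simp only [two_mul]
    rw [← cayley_add_one hr, ← cayley_add_one hs, h]
  rw [← sub_right_inj (a := (1 : R)), ← Ring.inverse_inverse hr, hinv, Ring.inverse_inverse hs]

end Algebra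

section CStarAlgebra

variable {A : Type*} [CStarAlgebra A] [PartialOrder A] [StarOrderedRing A]

theorem norm_lt_one_iff_isStrictlyPositive {a : A} (ha : 0 ≤ a) :
    ‖a‖ < 1 ↔ IsStrictlyPositive (1 - a) := by
  rcases subsingleton_or_nontrivial A with _ | _
  · simp [Subsingleton.elim a 0, IsStrictlyPositive.of_subsingleton]
  constructor
  · intro h
    exact ⟨sub_nonneg.2 ((CStarAlgebra.norm_le_one_iff_of_nonneg a ha).1 h.le),
      isUnit_one_sub_of_norm_lt_one h⟩
  · intro h
    have hmem : 1 - ‖a‖ ∈ spectrum ℝ (1 - a) := by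
      rw [← map_one (algebraMap ℝ A), ← spectrum.singleton_sub_eq]
      exact Set.sub_mem_sub rfl (CStarAlgebra.norm_mem_spectrum_of_nonneg ha)
    linarith [h.spectrum_pos hmem]

theorem isStrictlyPositive_cayley {r : A} (h0 : 0 ≤ r) (h1 : ‖r‖ < 1) :
    IsStrictlyPositive (cayley r) := by
  have hinv := ((norm_lt_one_iff_isStrictlyPositive h0).1 h1).ringInverse
  have hadd : IsStrictlyPositive (1 + r) := isStrictlyPositive_one.add_nonneg h0
  have hcomm : Commute (1 + r) (1 - r) :=
    (Commute.one_left _).add_left ((Commute.one_right r).sub_right (Commute.refl r))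
  exact ⟨(commute_ringInverse hcomm).mul_nonneg hadd.nonneg hinv.nonneg,
    hadd.isUnit.mul hinv.isUnit⟩

theorem isStrictlyPositive_exp {a : A} (ha : IsSelfAdjoint a) : IsStrictlyPositive (exp a) := by
  let _ : NormedAlgebra ℚ A := NormedAlgebra.restrictScalars ℚ ℝ A
  exact (isUnit_exp a).isStrictlyPositive ha.exp_nonneg

theorem abs_mul_of_nonneg {a b : A} (hb : 0 ≤ b) (h : Commute (CFC.abs a) b) :
    CFC.abs (a * b) = CFC.abs a * b := by
  refine CFC.sqrt_unique ?_ (h.mul_nonneg (CFC.abs_nonneg a) hb)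
  calc CFC.abs a * b * (CFC.abs a * b) = b * (CFC.abs a * CFC.abs a) * b := by
        rw [h.eq]; simp only [mul_assoc]; rw [h.eq]
    _ = star (a * b) * (a * b) := by
        rw [CFC.abs_mul_abs, star_mul, (IsSelfAdjoint.of_nonneg hb).star_eq]; noncomm_ring

theorem sqrt_unitary_conj {a u : A} (ha : 0 ≤ a) (hu : u ∈ unitary A) :
    CFC.sqrt (star u * a * u) = star u * CFC.sqrt a * u := by
  refine CFC.sqrt_unique ?_ (star_left_conjugate_nonneg (CFC.sqrt_nonneg a) u)
  calc star u * CFC.sqrt a * u * (star u * CFC.sqrt a * u)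
      = star u * CFC.sqrt a * (u * star u) * CFC.sqrt a * u := by noncomm_ring
    _ = star u * a * u := by
      rw [Unitary.mul_star_self_of_mem hu, mul_one, mul_assoc (star u),
        CFC.sqrt_mul_sqrt_self a]

end CStarAlgebra

section Exp

variable {B : Type*} [NormedRing B] [NormedAlgebra ℝ B]

/-- The value at `a` of the entire function `s ↦ cosh √s`. -/
noncomputable def coshSqrt (a : B) : B := ∑' k : ℕ, ((2 * k).factorial : ℝ)⁻¹ • a ^ k

/-- The value at `a` of the entire function `s ↦ sinh √s / √s`. -/
noncomputable def sinhcSqrt (a : B) : B := ∑' k : ℕ, ((2 * k + 1).factorial : ℝ)⁻¹ • a ^ k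

/-- The function `s ↦ tanh √s / √s`, at those `a` for which `coshSqrt a` is invertible. -/
noncomputable def tanhcSqrt (a : B) : B := sinhcSqrt a * Ring.inverse (coshSqrt a)

theorem commute_coshSqrt {a b : B} (h : Commute a b) : Commute a (coshSqrt b) :=
  Commute.tsum_right _ fun k => (h.pow_right k).smul_right _

theorem commute_sinhcSqrt {a b : B} (h : Commute a b) : Commute a (sinhcSqrt b) :=
  Commute.tsum_right _ fun k => (h.pow_right k).smul_right _

theorem commute_tanhcSqrt {a b : B} (h : Commute a b) : Commute a (tanhcSqrt b) :=
  (commute_sinhcSqrt h).mul_right (commute_ringInverse (commute_coshSqrt h))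

variable [CompleteSpace B]

theorem summable_inv_smul_pow_of_factorial_le {f : ℕ → ℕ} (hf : ∀ k, k.factorial ≤ f k) (a : B) :
    Summable fun k : ℕ => ((f k : ℝ))⁻¹ • a ^ k := by
  refine Summable.of_norm_bounded (norm_expSeries_summable' (𝕂 := ℝ) a) fun k => ?_
  have hle : (k.factorial : ℝ) ≤ f k := by exact_mod_cast hf k
  simp only [norm_smul, norm_inv, RCLike.norm_natCast]
  gcongr

theorem hasSum_coshSqrt (a : B) :
    HasSum (fun k : ℕ => ((2 * k).factorial : ℝ)⁻¹ • a ^ k) (coshSqrt a) :=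
  (summable_inv_smul_pow_of_factorial_le (fun _ => Nat.factorial_le (by lia)) a).hasSum

theorem hasSum_sinhcSqrt (a : B) :
    HasSum (fun k : ℕ => ((2 * k + 1).factorial : ℝ)⁻¹ • a ^ k) (sinhcSqrt a) :=
  (summable_inv_smul_pow_of_factorial_le (fun _ => Nat.factorial_le (by lia)) a).hasSum

theorem exp_eq_coshSqrt_add_mul_sinhcSqrt (p : B) :
    exp p = coshSqrt (p * p) + p * sinhcSqrt (p * p) := by
  have heven := hasSum_coshSqrt (p * p)
  have hodd := (hasSum_sinhcSqrt (p * p)).mul_left p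
  simp only [← pow_two, ← pow_mul, mul_smul_comm, ← pow_succ'] at heven hodd ⊢
  exact (exp_series_hasSum_exp' (𝕂 := ℝ) p).unique (heven.even_add_odd hodd)

theorem one_add_mul_tanhcSqrt {p : B} (hp : IsUnit (coshSqrt (p * p))) :
    1 + p * tanhcSqrt (p * p) = exp p * Ring.inverse (coshSqrt (p * p)) := by
  rw [exp_eq_coshSqrt_add_mul_sinhcSqrt, add_mul, Ring.mul_inverse_cancel _ hp, tanhcSqrt,
    mul_assoc]

theorem one_sub_mul_tanhcSqrt {p : B} (hp : IsUnit (coshSqrt (p * p))) :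
    1 - p * tanhcSqrt (p * p) = exp (-p) * Ring.inverse (coshSqrt (p * p)) := by
  simpa only [neg_mul_neg, neg_mul p (tanhcSqrt _), ← sub_eq_add_neg]
    using one_add_mul_tanhcSqrt (p := -p) (by rwa [neg_mul_neg])

theorem isUnit_one_sub_mul_tanhcSqrt {p : B} (hp : IsUnit (coshSqrt (p * p))) :
    IsUnit (1 - p * tanhcSqrt (p * p)) := by
  let _ : NormedAlgebra ℚ B := NormedAlgebra.restrictScalars ℚ ℝ B
  rw [one_sub_mul_tanhcSqrt hp]
  exact (isUnit_exp _).mul hp.ringInverse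

theorem cayley_mul_tanhcSqrt {p : B} (hp : IsUnit (coshSqrt (p * p))) :
    cayley (p * tanhcSqrt (p * p)) = exp ((2 : ℝ) • p) := by
  let _ : NormedAlgebra ℚ B := NormedAlgebra.restrictScalars ℚ ℝ B
  have hcomm : Commute (exp (-p)) (Ring.inverse (coshSqrt (p * p))) :=
    commute_ringInverse (commute_coshSqrt
      (((Commute.refl p).mul_right (Commute.refl p)).neg_left.exp_left))
  rw [cayley, one_add_mul_tanhcSqrt hp, one_sub_mul_tanhcSqrt hp, Ring.mul_inverse_rev' hcomm,
    Ring.inverse_inverse hp, Ring.inverse_exp, neg_neg, mul_assoc,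
    Ring.inverse_mul_cancel_left _ _ hp, two_smul, exp_add_of_commute (Commute.refl p)]

theorem hasDerivAt_exp_conj (X q : B) :
    HasDerivAt (fun t : ℝ => exp (t • X) * q * exp (-(t • X))) (X * q - q * X) 0 := by
  have hexp (Y : B) : HasDerivAt (fun t : ℝ => exp (t • Y)) Y 0 := by
    simpa using hasDerivAt_exp_smul_const (𝕂 := ℝ) Y 0
  have hneg := hexp (-X)
  simp only [smul_neg] at hneg
  convert ((hexp X).mul_const q).mul hneg using 1
  · rfl
  · simp [sub_eq_add_neg]

end Exp

section PolarTanh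

variable {A : Type*} [CStarAlgebra A]

theorem exp_unitary_conj (a : A) {u : A} (hu : u ∈ unitary A) :
    exp (star u * a * u) = star u * exp a * u := by
  let _ : NormedAlgebra ℚ A := NormedAlgebra.restrictScalars ℚ ℝ A
  exact exp_units_conj' (Unitary.toUnits ⟨u, hu⟩) a

/-- The hyperbolic tangent through the polar decomposition, `v |α| ↦ v tanh |α|`. It is the
exponential map of the disk at `0`. -/
noncomputable def polarTanh (α : A) : A := α * tanhcSqrt (star α * α)

variable [PartialOrder A] [StarOrderedRing A]

theorem one_le_of_hasSum_smul_pow {c : ℕ → ℝ} (h0 : c 0 = 1) (hc : ∀ k, 0 ≤ c k) {a b : A}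
    (ha : 0 ≤ a) (h : HasSum (fun k => c k • a ^ k) b) : 1 ≤ b := by
  have hle : c 0 • a ^ 0 ≤ b :=
    le_hasSum h 0 fun k _ => smul_nonneg (hc k) (CStarAlgebra.pow_nonneg ha k)
  simpa [h0] using hle

theorem isStrictlyPositive_coshSqrt {a : A} (ha : 0 ≤ a) : IsStrictlyPositive (coshSqrt a) :=
  isStrictlyPositive_one.of_le <|
    one_le_of_hasSum_smul_pow (by simp) (fun _ => by positivity) ha (hasSum_coshSqrt a)

theorem isStrictlyPositive_sinhcSqrt {a : A} (ha : 0 ≤ a) : IsStrictlyPositive (sinhcSqrt a) :=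
  isStrictlyPositive_one.of_le <|
    one_le_of_hasSum_smul_pow (by simp) (fun _ => by positivity) ha (hasSum_sinhcSqrt a)

theorem isStrictlyPositive_tanhcSqrt {a : A} (ha : 0 ≤ a) :
    IsStrictlyPositive (tanhcSqrt a) := by
  have hS := isStrictlyPositive_sinhcSqrt ha
  have hC := (isStrictlyPositive_coshSqrt ha).ringInverse
  have hcomm : Commute (sinhcSqrt a) (Ring.inverse (coshSqrt a)) :=
    commute_ringInverse (commute_coshSqrt (commute_sinhcSqrt (Commute.refl a)).symm)
  exact ⟨hcomm.mul_nonneg hS.nonneg hC.nonneg, hS.isUnit.mul hC.isUnit⟩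

theorem commute_abs_star_mul_self (α : A) : Commute (CFC.abs α) (star α * α) := by
  rw [← CFC.abs_mul_abs]
  exact (Commute.refl _).mul_right (Commute.refl _)

theorem abs_polarTanh (α : A) : CFC.abs (polarTanh α) = CFC.abs α * tanhcSqrt (star α * α) :=
  abs_mul_of_nonneg (isStrictlyPositive_tanhcSqrt (star_mul_self_nonneg α)).nonneg
    (commute_tanhcSqrt (commute_abs_star_mul_self α))

theorem cayley_abs_polarTanh (α : A) :
    cayley (CFC.abs (polarTanh α)) = exp ((2 : ℝ) • CFC.abs α) := by
  have hC := (isStrictlyPositive_coshSqrt (star_mul_self_nonneg α)).isUnit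
  rw [abs_polarTanh, ← CFC.abs_mul_abs, cayley_mul_tanhcSqrt (by rwa [CFC.abs_mul_abs])]

theorem polarTanh_injective : Function.Injective (polarTanh (A := A)) := by
  intro α β h
  have hsa (γ : A) : IsSelfAdjoint ((2 : ℝ) • CFC.abs γ) :=
    (IsSelfAdjoint.all _).smul (IsSelfAdjoint.of_nonneg (CFC.abs_nonneg γ))
  have habs : CFC.abs α = CFC.abs β := by
    refine smul_right_injective A (two_ne_zero (α := ℝ)) ?_
    simp only
    rw [← CFC.log_exp _ (hsa α), ← CFC.log_exp _ (hsa β), ← cayley_abs_polarTanh,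
      ← cayley_abs_polarTanh, h]
  have hsq : star α * α = star β * β := by rw [← CFC.abs_mul_abs, habs, CFC.abs_mul_abs]
  rw [polarTanh, polarTanh, hsq] at h
  exact (isStrictlyPositive_tanhcSqrt (star_mul_self_nonneg β)).isUnit.mul_left_injective h

theorem exists_mul_tanhcSqrt_eq {r : A} (h0 : 0 ≤ r) (h1 : ‖r‖ < 1) :
    ∃ p : A, IsSelfAdjoint p ∧ p * tanhcSqrt (p * p) = r := by
  set p := (1 / 2 : ℝ) • CFC.log (cayley r) with hp
  have hsa : IsSelfAdjoint p := (IsSelfAdjoint.all _).smul IsSelfAdjoint.log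
  have hC := (isStrictlyPositive_coshSqrt hsa.mul_self_nonneg).isUnit
  have h2 : IsUnit (2 : A) := by
    simpa only [map_ofNat] using (IsUnit.mk0 (2 : ℝ) two_ne_zero).map (algebraMap ℝ A)
  refine ⟨p, hsa, cayley_injOn h2 (isUnit_one_sub_mul_tanhcSqrt hC)
    ((norm_lt_one_iff_isStrictlyPositive h0).1 h1).isUnit ?_⟩
  rw [cayley_mul_tanhcSqrt hC, hp, smul_smul, mul_one_div_cancel two_ne_zero, one_smul,
    CFC.exp_log _ (isStrictlyPositive_cayley h0 h1)]

theorem exists_polarTanh_eq {z : A} (hz : ‖z‖ < 1) : ∃ α, polarTanh α = z := by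
  obtain ⟨p, hp, hpT⟩ := exists_mul_tanhcSqrt_eq (CFC.abs_nonneg z) (CFC.norm_abs (a := z) ▸ hz)
  have hT := isStrictlyPositive_tanhcSqrt hp.mul_self_nonneg
  have hcomm : Commute p (tanhcSqrt (p * p)) :=
    commute_tanhcSqrt ((Commute.refl p).mul_right (Commute.refl p))
  set T := tanhcSqrt (p * p) with hT_def
  refine ⟨z * Ring.inverse T, ?_⟩
  have hsq : star (z * Ring.inverse T) * (z * Ring.inverse T) = p * p := by
    calc star (z * Ring.inverse T) * (z * Ring.inverse T)
        = Ring.inverse T * (star z * z) * Ring.inverse T := by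
          rw [star_mul, ← Ring.inverse_star, hT.isSelfAdjoint.star_eq]; noncomm_ring
      _ = Ring.inverse T * T * p * p * (T * Ring.inverse T) := by
          rw [← CFC.abs_mul_abs, ← hpT]; nth_rw 1 [hcomm.eq]; noncomm_ring
      _ = p * p := by
          rw [Ring.inverse_mul_cancel _ hT.isUnit, Ring.mul_inverse_cancel _ hT.isUnit, one_mul,
            mul_one]
  rw [polarTanh, hsq, ← hT_def, mul_assoc, Ring.inverse_mul_cancel _ hT.isUnit, mul_one]

end PolarTanh

section MatrixExp

variable {B : Type*} [NormedRing B] {n : Type*} [Fintype n] [DecidableEq n]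

/-- The left action of an invertible matrix on column vectors, as an automorphism of the right
module. -/
def mulVecEquiv {R : Type*} [Ring R] (g : (Matrix n n R)ˣ) : (n → R) ≃ₗ[Rᵐᵒᵖ] (n → R) :=
  .ofLinearMap (Matrix.mulVecBilin R Rᵐᵒᵖ (g : Matrix n n R))
    (Matrix.mulVecBilin R Rᵐᵒᵖ (↑g⁻¹ : Matrix n n R))
    (LinearMap.ext fun x => by simp [Matrix.mulVec_mulVec])
    (LinearMap.ext fun x => by simp [Matrix.mulVec_mulVec])

variable [CompleteSpace B]

open scoped Matrix.Norms.Operator in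
theorem completeSpace_matrix : @CompleteSpace (Matrix n n B)
    (Matrix.linftyOpNormedRing (n := n) (α := B)).toMetricSpace.toUniformSpace :=
  -- The uniformity of the operator norm is the product uniformity.
  inferInstanceAs (CompleteSpace (n → n → B))

variable [NormedAlgebra ℝ B]

theorem hasSum_matrix_exp (X : Matrix n n B) :
    HasSum (fun k : ℕ => (k.factorial : ℝ)⁻¹ • X ^ k) (exp X) :=
  @exp_series_hasSum_exp' ℝ (Matrix n n B) _ _ _ Matrix.linftyOpNormedRing
    Matrix.linftyOpNormedAlgebra completeSpace_matrix X

theorem hasDerivAt_matrix_exp_conj (X q : Matrix n n B) :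
    HasDerivAt (fun t : ℝ => exp (t • X) * q * exp (-(t • X))) (X * q - q * X) 0 :=
  @hasDerivAt_exp_conj (Matrix n n B) Matrix.linftyOpNormedRing Matrix.linftyOpNormedAlgebra
    completeSpace_matrix X q

theorem matrix_exp_units_conj (g : (Matrix n n B)ˣ) (X : Matrix n n B) :
    exp ((g : Matrix n n B) * X * (↑g⁻¹ : Matrix n n B)) = g * exp X * (↑g⁻¹ : Matrix n n B) := by
  let _ : NormedAlgebra ℚ B := NormedAlgebra.restrictScalars ℚ ℝ B
  exact Matrix.exp_units_conj g X

theorem matrix_exp_mul_exp_neg (X : Matrix n n B) : exp X * exp (-X) = 1 := by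
  let _ : NormedAlgebra ℚ B := NormedAlgebra.restrictScalars ℚ ℝ B
  rw [← Matrix.exp_add_of_commute _ _ (Commute.refl X).neg_right, add_neg_cancel, exp_zero]

/-- The exponential of a matrix, as an element of the general linear group. -/
noncomputable def expUnit (X : Matrix n n B) : (Matrix n n B)ˣ where
  val := exp X
  inv := exp (-X)
  val_inv := matrix_exp_mul_exp_neg X
  inv_val := by simpa only [neg_neg] using matrix_exp_mul_exp_neg (-X)

theorem val_expUnit (X : Matrix n n B) : (expUnit X : Matrix n n B) = exp X := rfl

theorem val_inv_expUnit (X : Matrix n n B) :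
    ((expUnit X)⁻¹ : (Matrix n n B)ˣ) = exp (-X) := rfl

theorem expUnit_units_conj (g : (Matrix n n B)ˣ) (X : Matrix n n B) :
    expUnit ((g : Matrix n n B) * X * (↑g⁻¹ : Matrix n n B)) = g * expUnit X * g⁻¹ :=
  Units.ext (matrix_exp_units_conj g X)

theorem exp_mulVec_of_sq_mulVec_eq {X : Matrix n n B} {x : n → B} {b : B}
    (h : X *ᵥ (X *ᵥ x) = MulOpposite.op b • x) :
    exp X *ᵥ x = MulOpposite.op (coshSqrt b) • x + MulOpposite.op (sinhcSqrt b) • (X *ᵥ x) := by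
  have heven (k : ℕ) : X ^ (2 * k) *ᵥ x = MulOpposite.op (b ^ k) • x := by
    induction k with
    | zero => simp
    | succ k ih =>
      rw [Nat.mul_succ, pow_add, pow_two, ← Matrix.mulVec_mulVec, ← Matrix.mulVec_mulVec, h,
        Matrix.mulVec_smul, ih, smul_smul, ← MulOpposite.op_mul, pow_succ]
  have hodd (k : ℕ) : X ^ (2 * k + 1) *ᵥ x = MulOpposite.op (b ^ k) • (X *ᵥ x) := by
    rw [pow_succ', ← Matrix.mulVec_mulVec, heven, Matrix.mulVec_smul]
  have hsmul {f : ℕ → B} {s : B} (y : n → B) (hf : HasSum f s) :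
      HasSum (fun k => MulOpposite.op (f k) • y) (MulOpposite.op s • y) :=
    Pi.hasSum.2 fun i => hf.mul_left (y i)
  have hexp : HasSum (fun k : ℕ => (k.factorial : ℝ)⁻¹ • (X ^ k *ᵥ x)) (exp X *ᵥ x) := by
    simpa only [Function.comp_def, Matrix.mulVec.addMonoidHomLeft, AddMonoidHom.coe_mk,
      ZeroHom.coe_mk, Matrix.smul_mulVec] using (hasSum_matrix_exp X).map
        (Matrix.mulVec.addMonoidHomLeft x) (continuous_id.matrix_mulVec continuous_const)
  refine hexp.unique (HasSum.even_add_odd ?_ ?_)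
  · simpa only [heven, MulOpposite.op_smul, smul_assoc] using hsmul x (hasSum_coshSqrt b)
  · simpa only [hodd, MulOpposite.op_smul, smul_assoc] using hsmul (X *ᵥ x) (hasSum_sinhcSqrt b)

end MatrixExp

variable {A : Type*} [CStarAlgebra A]

section Theta

theorem theta_smul_right (x y : Vec A) (a : A) :
    theta x (MulOpposite.op a • y) = theta x y * a := by
  simp [theta, sub_mul, mul_assoc]

theorem theta_smul_left (x y : Vec A) (a : A) :
    theta (MulOpposite.op a • x) y = star a * theta x y := by
  simp [theta, mul_sub, mul_assoc]

theorem star_theta (x y : Vec A) : star (theta x y) = theta y x := by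
  simp [theta]

theorem theta_left_ext {y y' : Vec A} (h : ∀ x, theta x y = theta x y') : y = y' := by
  ext i
  fin_cases i
  · simpa [theta] using h ![1, 0]
  · simpa [theta] using h ![0, 1]

/-- The adjoint of a matrix with respect to the form `θ`. -/
def thetaAdj (g : Mat A) : Mat A :=
  !![star (g 0 0), -star (g 1 0); -star (g 0 1), star (g 1 1)]

theorem theta_mulVec_left (g : Mat A) (x y : Vec A) :
    theta (g *ᵥ x) y = theta x (thetaAdj g *ᵥ y) := by
  simp only [theta, thetaAdj, Matrix.mulVec_fin_two, Matrix.of_apply, Matrix.cons_val_zero,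
    Matrix.cons_val_one, Matrix.cons_val_fin_one, star_add, star_mul]
  noncomm_ring

theorem thetaAdj_smul (t : ℝ) (X : Mat A) : thetaAdj (t • X) = t • thetaAdj X := by
  ext i j
  fin_cases i <;> fin_cases j <;> simp [thetaAdj]

/-- The Gram matrix `diag(1, -1)` of `θ`, as a unit. -/
def signature : (Mat A)ˣ where
  val := !![1, 0; 0, -1]
  inv := !![1, 0; 0, -1]
  val_inv := by simp [Matrix.one_fin_two]
  inv_val := by simp [Matrix.one_fin_two]

theorem thetaAdj_eq_signature_conj (g : Mat A) :
    thetaAdj g = ((signature : (Mat A)ˣ) : Mat A) * gᴴ * ((signature⁻¹ : (Mat A)ˣ) : Mat A) := by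
  ext i j
  fin_cases i <;> fin_cases j <;>
    simp [thetaAdj, signature, Matrix.mul_apply, Fin.sum_univ_two, Units.inv_mk, Matrix.vecMul,
      dotProduct]

theorem thetaAdj_exp (X : Mat A) : thetaAdj (exp X) = exp (thetaAdj X) := by
  simp only [thetaAdj_eq_signature_conj, matrix_exp_units_conj, Matrix.exp_conjTranspose]

theorem isThetaUnitary_iff {g : (Mat A)ˣ} : IsThetaUnitary g ↔ thetaAdj (g : Mat A) * g = 1 := by
  constructor
  · intro h
    refine Matrix.ext_of_mulVec_single fun i => theta_left_ext fun x => ?_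
    rw [← Matrix.mulVec_mulVec, ← theta_mulVec_left, h, Matrix.one_mulVec]
  · intro h x y
    rw [theta_mulVec_left, Matrix.mulVec_mulVec, h, Matrix.one_mulVec]

theorem IsThetaUnitary.mul {g h : (Mat A)ˣ} (hg : IsThetaUnitary g) (hh : IsThetaUnitary h) :
    IsThetaUnitary (g * h) := fun x y => by
  rw [Units.val_mul, ← Matrix.mulVec_mulVec, ← Matrix.mulVec_mulVec, hg, hh]

theorem IsThetaUnitary.inv {g : (Mat A)ˣ} (hg : IsThetaUnitary g) :
    IsThetaUnitary g⁻¹ := fun x y => by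
  rw [← hg, Matrix.mulVec_mulVec, Matrix.mulVec_mulVec, Units.mul_inv, Matrix.one_mulVec,
    Matrix.one_mulVec]

theorem IsThetaUnitary.val_inv {g : (Mat A)ˣ} (hg : IsThetaUnitary g) :
    ((g⁻¹ : (Mat A)ˣ) : Mat A) = thetaAdj g :=
  Units.inv_eq_of_mul_eq_one_left (isThetaUnitary_iff.1 hg)

theorem theta_antisymm_iff {X : Mat A} :
    (∀ x y : Vec A, theta (X *ᵥ x) y + theta x (X *ᵥ y) = 0) ↔ thetaAdj X = -X := by
  have hadd (x y : Vec A) : theta (X *ᵥ x) y + theta x (X *ᵥ y)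
      = theta x ((thetaAdj X + X) *ᵥ y) := by
    rw [theta_mulVec_left, Matrix.add_mulVec]
    simp only [theta, Pi.add_apply]
    noncomm_ring
  have hzero (x : Vec A) : theta x 0 = 0 := by simp [theta]
  simp_rw [hadd, eq_neg_iff_add_eq_zero]
  constructor
  · intro h
    exact Matrix.ext_of_mulVec_single fun i => theta_left_ext fun x => by
      rw [h, Matrix.zero_mulVec, hzero]
  · intro h x y
    rw [h, Matrix.zero_mulVec, hzero]

theorem isThetaUnitary_expUnit {X : Mat A} (h : thetaAdj X = -X) : IsThetaUnitary (expUnit X) := by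
  rw [isThetaUnitary_iff, val_expUnit, thetaAdj_exp, h]
  exact (expUnit X).inv_val

theorem isThetaUnitary_expUnit_smul {X : Mat A} (h : thetaAdj X = -X) (t : ℝ) :
    IsThetaUnitary (expUnit (t • X)) :=
  isThetaUnitary_expUnit (by rw [thetaAdj_smul, h, smul_neg])

end Theta

section Codiag

/-- The horizontal matrix at `0` with velocity `α`. -/
def codiag (α : A) : Mat A := !![0, star α; α, 0]

theorem thetaAdj_codiag (α : A) : thetaAdj (codiag α) = -codiag α := by
  ext i j
  fin_cases i <;> fin_cases j <;> simp [thetaAdj, codiag]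

theorem codiag_mulVec (α : A) : codiag α *ᵥ ![1, 0] = ![0, α] := by
  simp [codiag]

theorem exp_codiag_mulVec (α : A) :
    exp (codiag α) *ᵥ ![1, 0] = ![coshSqrt (star α * α), α * sinhcSqrt (star α * α)] := by
  have hsq : codiag α *ᵥ (codiag α *ᵥ ![1, 0]) = MulOpposite.op (star α * α) • ![1, 0] := by
    rw [codiag_mulVec]
    simp [codiag]
  rw [exp_mulVec_of_sq_mulVec_eq hsq, codiag_mulVec]
  simp

theorem act_zero (g : Mat A) : act g 0 = g 1 0 * Ring.inverse (g 0 0) := by simp [act]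

theorem geodesic_codiag (α : A) : geodesic 0 (codiag α) 1 = polarTanh α := by
  have h0 : exp (codiag α) 0 0 = coshSqrt (star α * α) := by
    simpa using congrFun (exp_codiag_mulVec α) 0
  have h1 : exp (codiag α) 1 0 = α * sinhcSqrt (star α * α) := by
    simpa using congrFun (exp_codiag_mulVec α) 1
  rw [geodesic, one_smul, act_zero, h0, h1, polarTanh, tanhcSqrt, mul_assoc]

theorem isHorizontal_zero_iff {X : Mat A} : IsHorizontal 0 X ↔ ∃ α, X = codiag α := by
  have hproj : proj (0 : A) = !![1, 0; 0, 0] := by simp [proj]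
  have hcompl : (1 : Mat A) - !![1, 0; 0, 0] = !![0, 0; 0, 1] := by
    ext i j
    fin_cases i <;> fin_cases j <;> simp
  rw [IsHorizontal, theta_antisymm_iff, hproj, hcompl]
  constructor
  · rintro ⟨hX, h0, h1⟩
    refine ⟨X 1 0, ?_⟩
    have h00 : X 0 0 = 0 := by
      simpa [Matrix.mul_apply, Fin.sum_univ_two, Matrix.vecMul, dotProduct] using congrFun₂ h0 0 0
    have h11 : X 1 1 = 0 := by
      simpa [Matrix.mul_apply, Fin.sum_univ_two, Matrix.vecMul, dotProduct] using congrFun₂ h1 1 1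
    have h01 : star (X 1 0) = X 0 1 := by simpa [thetaAdj] using congrFun₂ hX 0 1
    rw [codiag, h01, ← h00, Matrix.eta_fin_two X, h00, h11]
    simp
  · rintro ⟨α, rfl⟩
    refine ⟨thetaAdj_codiag α, ?_, ?_⟩ <;> ext i j <;> fin_cases i <;> fin_cases j <;>
      simp [codiag, Matrix.mul_apply, Fin.sum_univ_two]

end Codiag

section Action

theorem act_one (z : A) : act (1 : Mat A) z = z := by simp [act]

theorem theta_mk_one_self (z : A) : theta ![1, z] ![1, z] = 1 - star z * z := by simp [theta]

theorem zero_mem_disk : (0 : A) ∈ disk A := by simp [disk]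

theorem mem_line_iff {z : A} {y : Vec A} : y ∈ line z ↔ y 1 = z * y 0 := by
  rw [line, Submodule.mem_span_singleton]
  constructor
  · rintro ⟨b, rfl⟩
    simp
  · intro h
    refine ⟨MulOpposite.op (y 0), ?_⟩
    ext i
    fin_cases i <;> simp [h]

theorem mk_one_mem_line (z : A) : ![1, z] ∈ line z := Submodule.mem_span_singleton_self _

theorem smul_mk_one_eq_of_mem_line {z : A} {y : Vec A} (hy : y ∈ line z) :
    MulOpposite.op (y 0) • ![1, z] = y := by
  ext i
  fin_cases i <;> simp [mem_line_iff.1 hy]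

theorem eq_of_mem_line {z w : A} {y : Vec A} (hz : y ∈ line z) (hw : y ∈ line w)
    (hy : IsUnit (y 0)) : z = w :=
  hy.mul_left_injective ((mem_line_iff.1 hz).symm.trans (mem_line_iff.1 hw))

theorem line_eq_span {z : A} {y : Vec A} (hy : y ∈ line z) (h0 : IsUnit (y 0)) :
    line z = Submodule.span Aᵐᵒᵖ {y} := by
  conv_rhs => rw [← smul_mk_one_eq_of_mem_line hy]
  exact (Submodule.span_singleton_smul_eq h0.op _).symm

theorem mulVec_mem_line_act {g : Mat A} {z : A} (h : IsUnit ((g *ᵥ ![1, z]) 0)) :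
    g *ᵥ ![1, z] ∈ line (act g z) := by
  have hact : act g z = (g *ᵥ ![1, z]) 1 * Ring.inverse ((g *ᵥ ![1, z]) 0) := by simp [act]
  rw [mem_line_iff, hact, Ring.inverse_mul_cancel_right _ _ h]

variable [PartialOrder A] [StarOrderedRing A]

theorem IsThetaUnitary.one_le_star_mul_self {g : (Mat A)ˣ} (hg : IsThetaUnitary g) :
    1 ≤ star ((g : Mat A) 0 0) * (g : Mat A) 0 0 := by
  have h : star ((g : Mat A) 0 0) * (g : Mat A) 0 0 - star ((g : Mat A) 1 0) * (g : Mat A) 1 0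
      = 1 := by
    simpa [theta] using hg ![1, 0] ![1, 0]
  rw [← h]
  exact sub_le_self _ (star_mul_self_nonneg _)

theorem IsThetaUnitary.isUnit_apply_zero_zero {g : (Mat A)ˣ} (hg : IsThetaUnitary g) :
    IsUnit ((g : Mat A) 0 0) := by
  have hinv : 1 ≤ (g : Mat A) 0 0 * star ((g : Mat A) 0 0) := by
    simpa [hg.val_inv, thetaAdj] using hg.inv.one_le_star_mul_self
  exact isUnit_of_isUnit_star_mul_self (CStarAlgebra.isUnit_of_le 1 hg.one_le_star_mul_self)
    (CStarAlgebra.isUnit_of_le 1 hinv)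

theorem IsThetaUnitary.isUnit_mulVec_mk_one_zero {g : (Mat A)ˣ} (hg : IsThetaUnitary g) :
    IsUnit (((g : Mat A) *ᵥ ![1, 0]) 0) := by
  simpa using hg.isUnit_apply_zero_zero

theorem exists_isThetaUnitary_act_zero_eq {z : A} (hz : z ∈ disk A) :
    ∃ g : (Mat A)ˣ, IsThetaUnitary g ∧ act (g : Mat A) 0 = z := by
  obtain ⟨α, rfl⟩ := exists_polarTanh_eq hz
  refine ⟨expUnit (codiag α), isThetaUnitary_expUnit (thetaAdj_codiag α), ?_⟩
  rw [← geodesic_codiag, geodesic, one_smul, val_expUnit]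

theorem IsThetaUnitary.isUnit_mulVec_zero {g : (Mat A)ˣ} (hg : IsThetaUnitary g) {z : A}
    (hz : z ∈ disk A) : IsUnit (((g : Mat A) *ᵥ ![1, z]) 0) := by
  obtain ⟨h, hh, rfl⟩ := exists_isThetaUnitary_act_zero_eq hz
  have hmem := mulVec_mem_line_act hh.isUnit_mulVec_mk_one_zero
  have hgh := (hg.mul hh).isUnit_mulVec_mk_one_zero
  obtain ⟨u, hu⟩ := hh.isUnit_mulVec_mk_one_zero
  rw [Units.val_mul, ← Matrix.mulVec_mulVec, ← smul_mk_one_eq_of_mem_line hmem, ← hu,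
    Matrix.mulVec_smul] at hgh
  exact (Units.isUnit_mul_units _ u).1 hgh

theorem mem_disk_iff {z : A} : z ∈ disk A ↔ IsStrictlyPositive (theta ![1, z] ![1, z]) := by
  rw [theta_mk_one_self, ← norm_lt_one_iff_isStrictlyPositive (star_mul_self_nonneg z),
    CStarRing.norm_star_mul_self, ← sq, sq_lt_one_iff₀ (norm_nonneg z)]
  rfl

theorem isStrictlyPositive_theta_self_iff {z : A} {y : Vec A} (hy : y ∈ line z)
    (h0 : IsUnit (y 0)) : IsStrictlyPositive (theta y y) ↔ z ∈ disk A := by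
  rw [← smul_mk_one_eq_of_mem_line hy, theta_smul_left, theta_smul_right, ← mul_assoc,
    h0.isStrictlyPositive_star_left_conjugate_iff, mem_disk_iff]

section

variable {g h : (Mat A)ˣ} {z w : A}

theorem act_mem_disk (hg : IsThetaUnitary g) (hz : z ∈ disk A) : act (g : Mat A) z ∈ disk A := by
  have hu := hg.isUnit_mulVec_zero hz
  rw [← isStrictlyPositive_theta_self_iff (mulVec_mem_line_act hu) hu, hg]
  exact mem_disk_iff.1 hz

theorem map_line (hg : IsThetaUnitary g) (hz : z ∈ disk A) :
    (line z).map (mulVecEquiv g : Vec A →ₗ[Aᵐᵒᵖ] Vec A) = line (act (g : Mat A) z) := by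
  have hu := hg.isUnit_mulVec_zero hz
  rw [line_eq_span (mulVec_mem_line_act hu) hu, line, Submodule.map_span, Set.image_singleton]
  rfl

/-- The isomorphism from `ℓ_z` onto `ℓ_{g · z}` given by the action of `g ∈ U(θ)` on `A²`. The
point `w = g · z` is a parameter of its own because the lines at equal points are not
definitionally equal. -/
def lineEquiv (hg : IsThetaUnitary g) (hz : z ∈ disk A) (h : act (g : Mat A) z = w) :
    line z ≃ₗ[Aᵐᵒᵖ] line w :=
  (mulVecEquiv g).ofSubmodules _ _ (h ▸ map_line hg hz)

theorem coe_lineEquiv (hg : IsThetaUnitary g) (hz : z ∈ disk A) (h : act (g : Mat A) z = w)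
    (y : line z) : (lineEquiv hg hz h y : Vec A) = (g : Mat A) *ᵥ y := rfl

theorem act_mul (hg : IsThetaUnitary g) (hh : IsThetaUnitary h) (hz : z ∈ disk A) :
    act ((g * h : (Mat A)ˣ) : Mat A) z = act (g : Mat A) (act (h : Mat A) z) := by
  have hu := (hg.mul hh).isUnit_mulVec_zero hz
  refine eq_of_mem_line (mulVec_mem_line_act hu) ?_ hu
  rw [Units.val_mul, ← Matrix.mulVec_mulVec]
  exact (lineEquiv hg (act_mem_disk hh hz) rfl
    (lineEquiv hh hz rfl ⟨![1, z], mk_one_mem_line z⟩)).2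

theorem act_inv_eq (hg : IsThetaUnitary g) (hz : z ∈ disk A) (h : act (g : Mat A) z = w) :
    act ((g⁻¹ : (Mat A)ˣ) : Mat A) w = z := by
  rw [← h, ← act_mul hg.inv hg hz, inv_mul_cancel, Units.val_one, act_one]

end

end Action

section NormalizedBasis

theorem isNormalized_zero : IsNormalized (⟨![1, 0], mk_one_mem_line 0⟩ : line (0 : A)) :=
  ⟨by simp [theta], isUnit_one⟩

theorem IsNormalized.smul_theta_eq {z : A} {x : line z} (hx : IsNormalized x) (y : line z) :
    MulOpposite.op (theta (x : Vec A) y) • x = y := by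
  have hy : (y : Vec A) ∈ Submodule.span Aᵐᵒᵖ {(x : Vec A)} := by
    rw [← line_eq_span x.2 hx.2]
    exact y.2
  obtain ⟨b, hb⟩ := Submodule.mem_span_singleton.1 hy
  have hθ : theta (x : Vec A) y = b.unop := by
    rw [← hb, ← MulOpposite.op_unop b, theta_smul_right, hx.1, one_mul, MulOpposite.op_unop]
  exact Subtype.ext (by rw [hθ, MulOpposite.op_unop, Submodule.coe_smul, hb])

theorem IsNormalized.proj_mulVec {z : A} {x : line z} (hx : IsNormalized x) (y : Vec A) :
    proj z *ᵥ y = MulOpposite.op (theta (x : Vec A) y) • (x : Vec A) := by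
  obtain ⟨hθ, u, hu⟩ := hx
  have hxu := smul_mk_one_eq_of_mem_line x.2
  rw [← hu] at hxu
  have hD : star (u : A) * (1 - star z * z) * u = 1 := by
    rwa [← hxu, theta_smul_left, theta_smul_right, theta_mk_one_self, ← mul_assoc] at hθ
  have hD' : 1 - star z * z = (((star u)⁻¹ * u⁻¹ : Aˣ) : A) := by
    rw [Units.val_mul, Units.eq_inv_mul_iff_mul_eq, Units.coe_star,
      ← Units.mul_eq_one_iff_eq_inv, hD]
  have hinv : Ring.inverse (1 - star z * z) = u * star (u : A) := by
    rw [hD', Ring.inverse_unit]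
    simp
  rw [← hxu, theta_smul_left, proj, hinv, smul_smul, ← MulOpposite.op_mul, theta]
  ext i
  fin_cases i <;>
    simp only [Fin.zero_eta, Fin.mk_one, Matrix.mulVec_fin_two, Matrix.of_apply,
      Matrix.cons_val_zero, Matrix.cons_val_one, Matrix.cons_val_fin_one, Pi.smul_apply,
      MulOpposite.smul_eq_mul_unop, MulOpposite.unop_op, star_one] <;>
    noncomm_ring

variable [PartialOrder A] [StarOrderedRing A] {g : (Mat A)ˣ} {z w : A}

theorem IsNormalized.lineEquiv {x : line z} (hx : IsNormalized x) (hg : IsThetaUnitary g)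
    (hz : z ∈ disk A) (h : act (g : Mat A) z = w) : IsNormalized (lineEquiv hg hz h x) := by
  refine ⟨by rw [coe_lineEquiv, hg, hx.1], ?_⟩
  rw [coe_lineEquiv, ← smul_mk_one_eq_of_mem_line x.2, Matrix.mulVec_smul]
  exact (hg.isUnit_mulVec_zero hz).mul hx.2

theorem exists_isNormalized (hz : z ∈ disk A) : ∃ x : line z, IsNormalized x := by
  obtain ⟨g, hg, h⟩ := exists_isThetaUnitary_act_zero_eq hz
  exact ⟨_, isNormalized_zero.lineEquiv hg zero_mem_disk h⟩

theorem proj_act (hg : IsThetaUnitary g) (hz : z ∈ disk A) :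
    proj (act (g : Mat A) z) = g * proj z * ((g⁻¹ : (Mat A)ˣ) : Mat A) := by
  obtain ⟨x, hx⟩ := exists_isNormalized hz
  rw [Units.eq_mul_inv_iff_mul_eq]
  refine Matrix.ext_of_mulVec_single fun i => ?_
  rw [← Matrix.mulVec_mulVec, ← Matrix.mulVec_mulVec, hx.proj_mulVec,
    (hx.lineEquiv hg hz rfl).proj_mulVec, coe_lineEquiv, hg, Matrix.mulVec_smul]

end NormalizedBasis

section Geodesic

variable {g : (Mat A)ˣ} {z z₀ z₁ : A} {X : Mat A}

theorem IsHorizontal.thetaAdj_eq (hX : IsHorizontal z X) : thetaAdj X = -X :=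
  theta_antisymm_iff.1 hX.1

theorem geodesic_one_eq_act_expUnit (z : A) (X : Mat A) :
    geodesic z X 1 = act (expUnit X : Mat A) z := by
  rw [geodesic, one_smul, val_expUnit]

/-- The initial velocity of `t ↦ q_{exp(tX) · z}`, the tangent vector at `q_z` defined by `X`. -/
noncomputable def velocity (z : A) (X : Mat A) : Mat A := X * proj z - proj z * X

theorem velocity_mulVec (hX : IsHorizontal z X) {x : line z} (hx : IsNormalized x) :
    velocity z X *ᵥ (x : Vec A) = X *ᵥ (x : Vec A) := by
  have hproj : proj z *ᵥ (x : Vec A) = x := by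
    rw [hx.proj_mulVec, hx.1, MulOpposite.op_one, one_smul]
  have hcodiag : (proj z * X) *ᵥ (x : Vec A) = 0 := by
    rw [← hproj, Matrix.mulVec_mulVec, hX.2.1, Matrix.zero_mulVec]
  rw [velocity, Matrix.sub_mulVec, hcodiag, sub_zero, ← Matrix.mulVec_mulVec, hproj]

variable [PartialOrder A] [StarOrderedRing A]

theorem proj_geodesic (hz : z ∈ disk A) (hX : thetaAdj X = -X) (t : ℝ) :
    proj (geodesic z X t) = exp (t • X) * proj z * exp (-(t • X)) := by
  rw [geodesic, ← val_expUnit (t • X), ← val_inv_expUnit (t • X),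
    proj_act (isThetaUnitary_expUnit_smul hX t) hz]

theorem hasDerivAt_proj_geodesic (hz : z ∈ disk A) (hX : thetaAdj X = -X) :
    HasDerivAt (fun t : ℝ => proj (geodesic z X t)) (velocity z X) 0 := by
  simp_rw [proj_geodesic hz hX]
  exact hasDerivAt_matrix_exp_conj X (proj z)

theorem hasDerivAt_refl_geodesic (hz : z ∈ disk A) (hX : thetaAdj X = -X) :
    HasDerivAt (fun t : ℝ => refl (geodesic z X t)) ((2 : ℝ) • velocity z X) 0 := by
  have hrefl (t : ℝ) : refl (geodesic z X t) = exp (t • X) * refl z * exp (-(t • X)) := by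
    rw [refl, refl, proj_geodesic hz hX, mul_sub, sub_mul, mul_one, matrix_exp_mul_exp_neg]
    noncomm_ring
  have hvel : (2 : ℝ) • velocity z X = X * refl z - refl z * X := by
    rw [velocity, refl, two_smul]
    noncomm_ring
  simp_rw [hrefl, hvel]
  exact hasDerivAt_matrix_exp_conj X (refl z)

theorem IsHorizontal.conj (hg : IsThetaUnitary g) (hz : z ∈ disk A) (hX : IsHorizontal z X) :
    IsHorizontal (act (g : Mat A) z) ((g : Mat A) * X * ((g⁻¹ : (Mat A)ˣ) : Mat A)) := by
  have hconj (p : Mat A) : (g : Mat A) * p * ((g⁻¹ : (Mat A)ˣ) : Mat A) *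
      ((g : Mat A) * X * ((g⁻¹ : (Mat A)ˣ) : Mat A)) *
      ((g : Mat A) * p * ((g⁻¹ : (Mat A)ˣ) : Mat A)) =
      (g : Mat A) * (p * X * p) * ((g⁻¹ : (Mat A)ˣ) : Mat A) := by
    simp only [mul_assoc, Units.inv_mul_cancel_left]
  have hcompl : 1 - proj (act (g : Mat A) z) =
      g * (1 - proj z) * ((g⁻¹ : (Mat A)ˣ) : Mat A) := by
    rw [proj_act hg hz, mul_sub, sub_mul, mul_one, Units.mul_inv]
  refine ⟨fun x y => ?_, ?_, ?_⟩
  · have h := hX.1 (((g⁻¹ : (Mat A)ˣ) : Mat A) *ᵥ x) (((g⁻¹ : (Mat A)ˣ) : Mat A) *ᵥ y)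
    rw [← hg, ← hg (((g⁻¹ : (Mat A)ˣ) : Mat A) *ᵥ x)] at h
    simpa only [Matrix.mulVec_mulVec, Units.mul_inv, Matrix.one_mulVec, mul_assoc] using h
  · rw [proj_act hg hz, hconj, hX.2.1, mul_zero, zero_mul]
  · rw [hcompl, hconj, hX.2.2, mul_zero, zero_mul]

theorem Joins.conj (hg : IsThetaUnitary g) (hz : z₀ ∈ disk A) (hX : Joins z₀ z₁ X) :
    Joins (act (g : Mat A) z₀) (act (g : Mat A) z₁)
      ((g : Mat A) * X * ((g⁻¹ : (Mat A)ˣ) : Mat A)) := by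
  obtain ⟨hX, rfl⟩ := hX
  have hexp := isThetaUnitary_expUnit hX.thetaAdj_eq
  refine ⟨hX.conj hg hz, ?_⟩
  rw [geodesic_one_eq_act_expUnit, geodesic_one_eq_act_expUnit, expUnit_units_conj,
    ← act_mul ((hg.mul hexp).mul hg.inv) hg hz, inv_mul_cancel_right, act_mul hg hexp hz]

theorem existsUnique_joins_zero (hz : z ∈ disk A) : ∃! X : Mat A, Joins 0 z X := by
  obtain ⟨α, rfl⟩ := exists_polarTanh_eq hz
  refine ⟨codiag α, ⟨isHorizontal_zero_iff.2 ⟨α, rfl⟩, geodesic_codiag α⟩, ?_⟩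
  rintro Y ⟨hY, hβ⟩
  obtain ⟨β, rfl⟩ := isHorizontal_zero_iff.1 hY
  rw [geodesic_codiag] at hβ
  rw [polarTanh_injective hβ]

theorem existsUnique_joins (h₀ : z₀ ∈ disk A) (h₁ : z₁ ∈ disk A) :
    ∃! X : Mat A, Joins z₀ z₁ X := by
  obtain ⟨g, hg, h0⟩ := exists_isThetaUnitary_act_zero_eq h₀
  obtain ⟨X, hX, huniq⟩ := existsUnique_joins_zero (act_mem_disk hg.inv h₁)
  have hg₁ : act (g : Mat A) (act ((g⁻¹ : (Mat A)ˣ) : Mat A) z₁) = z₁ := by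
    simpa only [inv_inv] using act_inv_eq hg.inv h₁ rfl
  refine ⟨_, by simpa only [h0, hg₁] using hX.conj hg zero_mem_disk, fun Y hY => ?_⟩
  have hY' := hY.conj hg.inv h₀
  rw [act_inv_eq hg zero_mem_disk h0] at hY'
  rw [← huniq _ hY', inv_inv]
  simp only [mul_assoc, Units.mul_inv_cancel_left, Units.mul_inv, mul_one]

end Geodesic

section Coefficients

variable {z : A} {x : line z}

theorem IsNormalized.matrixOf_injective (hx : IsNormalized x) :
    Function.Injective (matrixOf x) := by
  intro φ ψ h
  have hφψ : φ x = ψ x := by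
    rw [← hx.smul_theta_eq (φ x), ← hx.smul_theta_eq (ψ x)]
    exact congrArg (fun a => MulOpposite.op a • x) h
  ext1 y
  rw [← hx.smul_theta_eq y, map_smul, map_smul, hφψ]

theorem IsNormalized.matrixOf_endOf (hx : IsNormalized x) (a : A) :
    matrixOf x (endOf x a) = a := by
  rw [matrixOf, endOf, LinearMap.coe_mk, AddHom.coe_mk, Submodule.coe_smul, theta_smul_right,
    hx.1, one_mul, mul_one]

theorem theta_smul_smul (r s : ℝ) (v w : Vec A) : theta (r • v) (s • w) = (r * s) • theta v w := by
  simp [theta, smul_sub, smul_smul, mul_comm]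

theorem matrixOf_smul (r : ℝ) (φ : Module.End Aᵐᵒᵖ (line z)) :
    matrixOf x (r • φ) = r • matrixOf x φ := by
  simpa [matrixOf] using theta_smul_smul 1 r (x : Vec A) (φ x)

theorem normEnd_smul (r : ℝ) (φ : Module.End Aᵐᵒᵖ (line z)) :
    normEnd x (r • φ) = |r| * normEnd x φ := by
  rw [normEnd, matrixOf_smul, norm_smul, Real.norm_eq_abs, normEnd]

theorem matrixOf_op_smul (u : A) (φ : Module.End Aᵐᵒᵖ (line z)) :
    matrixOf (MulOpposite.op u • x) φ = star u * matrixOf x φ * u := by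
  rw [matrixOf, map_smul, Submodule.coe_smul, Submodule.coe_smul, theta_smul_left,
    theta_smul_right, mul_assoc, matrixOf]

theorem IsNormalized.theta_mem_unitary {y : line z} (hx : IsNormalized x) (hy : IsNormalized y) :
    theta (x : Vec A) y ∈ unitary A := by
  have hmul {v w : line z} (hv : IsNormalized v) (hw : IsNormalized w) :
      theta (w : Vec A) v * theta (v : Vec A) w = 1 := by
    rw [← theta_smul_right, ← Submodule.coe_smul, hv.smul_theta_eq, hw.1]
  rw [Unitary.mem_iff, star_theta]
  exact ⟨hmul hx hy, hmul hy hx⟩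

theorem finslerNorm_smul (r : ℝ) (V : Mat A) : finslerNorm x (r • V) = |r| * finslerNorm x V := by
  rw [finslerNorm, finslerNorm, Matrix.smul_mulVec, theta_smul_smul, norm_smul, Real.norm_eq_abs,
    abs_mul, Real.sqrt_mul (mul_nonneg (abs_nonneg r) (abs_nonneg r)),
    Real.sqrt_mul_self (abs_nonneg r)]

theorem matrixOf_innerEnd_smul (hx : IsNormalized x) (V : Mat A) (r : ℝ) :
    matrixOf x (innerEnd x (r • V) (r • V)) = (r * r) • matrixOf x (innerEnd x V V) := by
  rw [innerEnd, innerEnd, hx.matrixOf_endOf, hx.matrixOf_endOf, Matrix.smul_mulVec,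
    theta_smul_smul, smul_neg]

variable [PartialOrder A] [StarOrderedRing A] {V : Mat A}

theorem finslerNorm_eq_normEnd_modulus (hx : IsNormalized x)
    (hV : 0 ≤ matrixOf x (innerEnd x V V)) : finslerNorm x V = normEnd x (modulus x V) := by
  rw [normEnd, modulus, sqrtEnd, hx.matrixOf_endOf, CFC.norm_sqrt _ hV, innerEnd,
    hx.matrixOf_endOf, norm_neg, finslerNorm]

theorem isSelfAdjoint_matrixOf_modulus (hx : IsNormalized x) (V : Mat A) :
    IsSelfAdjoint (matrixOf x (modulus x V)) := by
  rw [modulus, sqrtEnd, hx.matrixOf_endOf]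
  exact IsSelfAdjoint.of_nonneg (CFC.sqrt_nonneg _)

theorem modulus_smul (hx : IsNormalized x) (hV : 0 ≤ matrixOf x (innerEnd x V V)) {r : ℝ}
    (hr : 0 ≤ r) : modulus x (r • V) = r • modulus x V := by
  refine hx.matrixOf_injective ?_
  rw [matrixOf_smul, modulus, modulus, sqrtEnd, sqrtEnd, hx.matrixOf_endOf, hx.matrixOf_endOf,
    matrixOf_innerEnd_smul hx]
  refine CFC.sqrt_unique ?_ (smul_nonneg hr (CFC.sqrt_nonneg _))
  rw [smul_mul_smul_comm, CFC.sqrt_mul_sqrt_self _]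

end Coefficients

section CrossRatio

theorem forall_exists_mulVec_iff {z w : A} {m : Mat A} (e : line z ≃ₗ[Aᵐᵒᵖ] line w)
    (he : ∀ y : line z, (e y : Vec A) = m *ᵥ y) {φ : Module.End Aᵐᵒᵖ (line z)}
    {φ' : Module.End Aᵐᵒᵖ (line w)} :
    (∀ y : line z, ∃ y₁ : line w, (y₁ : Vec A) = m *ᵥ y ∧ (φ' y₁ : Vec A) = m *ᵥ φ y) ↔
      φ' = e.conjRingEquiv φ := by
  constructor
  · intro h
    ext1 y
    obtain ⟨y₁, hy₁, hφ⟩ := h (e.symm y)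
    rw [← he] at hy₁ hφ
    rw [Subtype.ext hy₁, e.apply_symm_apply] at hφ
    exact Subtype.ext hφ
  · rintro rfl y
    exact ⟨e y, he y, by simp [he]⟩

variable [PartialOrder A] [StarOrderedRing A] {z₀ z₁ : A} {X : Mat A}
  {φ : Module.End Aᵐᵒᵖ (line z₁)} {ψ : Module.End Aᵐᵒᵖ (line z₀)} {x : line z₀}

/-- The parallel transport `ℓ_{z₀} → ℓ_{z₁}` along the geodesic with velocity `X`. -/
noncomputable def transportEquiv (h₀ : z₀ ∈ disk A) (hX : Joins z₀ z₁ X) :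
    line z₀ ≃ₗ[Aᵐᵒᵖ] line z₁ :=
  lineEquiv (isThetaUnitary_expUnit hX.1.thetaAdj_eq) h₀
    ((geodesic_one_eq_act_expUnit z₀ X).symm.trans hX.2)

theorem isTransport_iff (h₀ : z₀ ∈ disk A) (hX : Joins z₀ z₁ X) :
    IsTransport X φ ψ ↔ φ = (transportEquiv h₀ hX).conjRingEquiv ψ :=
  forall_exists_mulVec_iff _ fun _ => rfl

theorem existsUnique_isTransport (h₀ : z₀ ∈ disk A) (hX : Joins z₀ z₁ X)
    (φ : Module.End Aᵐᵒᵖ (line z₁)) : ∃! ψ : Module.End Aᵐᵒᵖ (line z₀), IsTransport X φ ψ := by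
  simp_rw [isTransport_iff h₀ hX, eq_comm (a := φ)]
  exact (transportEquiv h₀ hX).conjRingEquiv.bijective.existsUnique φ

theorem exists_isCrossRatio (h₀ : z₀ ∈ disk A) (h₁ : z₁ ∈ disk A) :
    ∃ φ : Module.End Aᵐᵒᵖ (line z₁), IsCrossRatio z₀ z₁ φ := by
  obtain ⟨g, hg, h0⟩ := exists_isThetaUnitary_act_zero_eq h₀
  have hg₁ : act (g : Mat A) (act ((g⁻¹ : (Mat A)ˣ) : Mat A) z₁) = z₁ := by
    simpa only [inv_inv] using act_inv_eq hg.inv h₁ rfl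
  exact ⟨_, g, hg, h0, (forall_exists_mulVec_iff (lineEquiv hg (act_mem_disk hg.inv h₁) hg₁)
    (coe_lineEquiv hg _ hg₁)).2 rfl⟩

theorem crZero_exp_codiag_mulVec {z α : A} (hα : polarTanh α = z) {y : line z}
    (hy : (y : Vec A) = exp (codiag α) *ᵥ ![1, 0]) :
    (crZero z y : Vec A) = MulOpposite.op (exp ((2 : ℝ) • CFC.abs α)) • (y : Vec A) := by
  have hy0 : (y : Vec A) 0 = coshSqrt (star α * α) := by
    rw [hy, exp_codiag_mulVec, Matrix.cons_val_zero]
  have hcomm : Commute (cayley (CFC.abs z)) (coshSqrt (star α * α)) := by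
    rw [← hα, cayley_abs_polarTanh]
    exact commute_coshSqrt (((commute_abs_star_mul_self α).smul_left 2).exp_left)
  rw [← cayley_abs_polarTanh, hα]
  conv_rhs => rw [← smul_mk_one_eq_of_mem_line y.2, smul_smul, ← MulOpposite.op_mul, hy0,
    ← hcomm.eq, ← hy0]
  rfl

/-- Conjugating by `g` with `g · 0 = z₀` reduces the transport of the cross ratio to the vector
`e^{codiag α} (1, 0)` of `ℓ_{tanh α}`, on which `cr(0, tanh α)` acts as `exp (2 |α|)`. -/
theorem IsCrossRatio.exists_matrixOf_eq (h : IsCrossRatio z₀ z₁ φ) (h₀ : z₀ ∈ disk A)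
    (hX : Joins z₀ z₁ X) (hψ : IsTransport X φ ψ) :
    ∃ x : line z₀, IsNormalized x ∧ ∃ α : A,
      theta (X *ᵥ (x : Vec A)) (X *ᵥ (x : Vec A)) = -(star α * α) ∧
      matrixOf x ψ = exp ((2 : ℝ) • CFC.abs α) := by
  obtain ⟨g, hg, h0, hcr⟩ := h
  have hY := hX.conj hg.inv h₀
  rw [act_inv_eq hg zero_mem_disk h0, inv_inv] at hY
  obtain ⟨α, hα⟩ := isHorizontal_zero_iff.1 hY.1
  obtain rfl : X = (g : Mat A) * codiag α * ((g⁻¹ : (Mat A)ˣ) : Mat A) := by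
    rw [← hα]
    simp only [mul_assoc, Units.mul_inv_cancel_left, Units.mul_inv, mul_one]
  rw [hα] at hY
  let e : line (0 : A) := ⟨![1, 0], mk_one_mem_line 0⟩
  let x : line z₀ := lineEquiv hg zero_mem_disk h0 e
  have hx : IsNormalized x := isNormalized_zero.lineEquiv hg zero_mem_disk h0
  have hconj (m : Mat A) : ((g : Mat A) * m * ((g⁻¹ : (Mat A)ˣ) : Mat A)) *ᵥ (x : Vec A)
      = (g : Mat A) *ᵥ (m *ᵥ ![1, 0]) := by
    rw [coe_lineEquiv, Matrix.mulVec_mulVec, Units.inv_mul_cancel_right, Matrix.mulVec_mulVec]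
  refine ⟨x, hx, α, ?_, ?_⟩
  · rw [hconj, hg, codiag_mulVec]
    simp [theta]
  have hψx : (ψ x : Vec A) = MulOpposite.op (exp ((2 : ℝ) • CFC.abs α)) • (x : Vec A) := by
    obtain ⟨y₁, hy₁, hφ⟩ := hcr (transportEquiv zero_mem_disk hY e)
    obtain ⟨y₂, hy₂, hφ'⟩ := hψ x
    have hexp := hconj (exp (codiag α))
    rw [← matrix_exp_units_conj] at hexp
    obtain rfl : y₂ = y₁ := Subtype.ext (hy₂.trans (hexp.trans hy₁.symm))
    refine (mulVecEquiv (expUnit _)).injective (hφ'.symm.trans (hφ.trans ?_))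
    rw [crZero_exp_codiag_mulVec (geodesic_codiag α ▸ hY.2) rfl, Matrix.mulVec_smul, ← hy₁, hy₂,
      ← Matrix.mulVec_smul]
    rfl
  rw [matrixOf, hψx, theta_smul_right, hx.1, one_mul]

theorem matrixOf_transport_eq (h₀ : z₀ ∈ disk A) (hX : Joins z₀ z₁ X)
    (hφ : IsCrossRatio z₀ z₁ φ) (hψ : IsTransport X φ ψ) (hx : IsNormalized x) :
    0 ≤ -theta (X *ᵥ (x : Vec A)) (X *ᵥ (x : Vec A)) ∧
      matrixOf x ψ
        = exp ((2 : ℝ) • CFC.sqrt (-theta (X *ᵥ (x : Vec A)) (X *ᵥ (x : Vec A)))) := by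
  obtain ⟨y, hy, α, hθ, hmat⟩ := hφ.exists_matrixOf_eq h₀ hX hψ
  have hu := hy.theta_mem_unitary hx
  rw [← hy.smul_theta_eq x, matrixOf_op_smul, hmat, Submodule.coe_smul, Matrix.mulVec_smul,
    theta_smul_left, theta_smul_right, hθ]
  set u := theta (y : Vec A) x
  have hneg : -(star u * (-(star α * α) * u)) = star u * (star α * α) * u := by noncomm_ring
  rw [hneg, sqrt_unitary_conj (star_mul_self_nonneg α) hu, ← exp_unitary_conj _ hu, CFC.abs,
    mul_smul_comm, smul_mul_assoc]
  exact ⟨star_left_conjugate_nonneg (star_mul_self_nonneg α) u, rfl⟩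

theorem IsCrossRatio.unique (h₀ : z₀ ∈ disk A) (h₁ : z₁ ∈ disk A)
    {φ' : Module.End Aᵐᵒᵖ (line z₁)} (hφ : IsCrossRatio z₀ z₁ φ) (hφ' : IsCrossRatio z₀ z₁ φ') :
    φ = φ' := by
  obtain ⟨X, hX, -⟩ := existsUnique_joins h₀ h₁
  obtain ⟨x, hx⟩ := exists_isNormalized h₀
  obtain ⟨ψ, hψ, -⟩ := existsUnique_isTransport h₀ hX φ
  obtain ⟨ψ', hψ', -⟩ := existsUnique_isTransport h₀ hX φ'
  have hψψ' : ψ = ψ' := hx.matrixOf_injective <|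
    (matrixOf_transport_eq h₀ hX hφ hψ hx).2.trans (matrixOf_transport_eq h₀ hX hφ' hψ' hx).2.symm
  rw [(isTransport_iff h₀ hX).1 hψ, (isTransport_iff h₀ hX).1 hψ', hψψ']

theorem existsUnique_isCrossRatio (h₀ : z₀ ∈ disk A) (h₁ : z₁ ∈ disk A) :
    ∃! φ : Module.End Aᵐᵒᵖ (line z₁), IsCrossRatio z₀ z₁ φ := by
  obtain ⟨φ, hφ⟩ := exists_isCrossRatio h₀ h₁
  exact ⟨φ, hφ, fun _ hφ' => hφ'.unique h₀ h₁ hφ⟩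

theorem logEnd_eq_smul_modulus {z : A} {x : line z} (hx : IsNormalized x)
    {χ : Module.End Aᵐᵒᵖ (line z)} {V : Mat A}
    (h : matrixOf x χ = exp ((2 : ℝ) • matrixOf x (modulus x V))) :
    logEnd x χ = (2 : ℝ) • modulus x V := by
  have hsa : IsSelfAdjoint ((2 : ℝ) • matrixOf x (modulus x V)) :=
    (IsSelfAdjoint.all _).smul (isSelfAdjoint_matrixOf_modulus hx V)
  refine hx.matrixOf_injective ?_
  rw [logEnd, hx.matrixOf_endOf, h, CFC.log_exp _ hsa, matrixOf_smul]

theorem matrixOf_transport_eq_exp_modulus (h₀ : z₀ ∈ disk A) (hX : Joins z₀ z₁ X)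
    (hφ : IsCrossRatio z₀ z₁ φ) (hψ : IsTransport X φ ψ) (hx : IsNormalized x) :
    0 ≤ matrixOf x (innerEnd x (velocity z₀ X) (velocity z₀ X)) ∧
      matrixOf x ψ = exp ((2 : ℝ) • matrixOf x (modulus x (velocity z₀ X))) := by
  simpa only [modulus, sqrtEnd, innerEnd, hx.matrixOf_endOf, velocity_mulVec hX.1 hx]
    using matrixOf_transport_eq h₀ hX hφ hψ hx

end CrossRatio

end PoincareDisk

theorem corollary10p2 {A : Type*} [CStarAlgebra A] [PartialOrder A] [StarOrderedRing A]
    (z₀ z₁ : A) (h₀ : z₀ ∈ PoincareDisk.disk A) (h₁ : z₁ ∈ PoincareDisk.disk A)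
    (hne : z₀ ≠ z₁) :
    -- the geodesic from `z₀` to `z₁`, the cross ratio, its parallel transport to `ℓ_{z₀}` and a
    -- normalized basis of `ℓ_{z₀}` exist; the first three are unique
    (∃! X : PoincareDisk.Mat A, PoincareDisk.Joins z₀ z₁ X) ∧
    (∃! φ : Module.End Aᵐᵒᵖ (PoincareDisk.line z₁), PoincareDisk.IsCrossRatio z₀ z₁ φ) ∧
    (∀ (X : PoincareDisk.Mat A) (φ : Module.End Aᵐᵒᵖ (PoincareDisk.line z₁)),
      PoincareDisk.Joins z₀ z₁ X → PoincareDisk.IsCrossRatio z₀ z₁ φ →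
      ∃! ψ : Module.End Aᵐᵒᵖ (PoincareDisk.line z₀), PoincareDisk.IsTransport X φ ψ) ∧
    (∃ x : PoincareDisk.line z₀, PoincareDisk.IsNormalized x) ∧
    -- the formulas
    (∀ (X : PoincareDisk.Mat A) (φ : Module.End Aᵐᵒᵖ (PoincareDisk.line z₁))
      (ψ : Module.End Aᵐᵒᵖ (PoincareDisk.line z₀)),
      PoincareDisk.Joins z₀ z₁ X → PoincareDisk.IsCrossRatio z₀ z₁ φ →
      PoincareDisk.IsTransport X φ ψ →
      -- `V` is `Log_{z₀}(z₁)`, the initial velocity of the geodesic, in the model of projections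
      ∃ V : PoincareDisk.Mat A,
        HasDerivAt (fun t : ℝ => PoincareDisk.proj (PoincareDisk.geodesic z₀ X t)) V 0 ∧
        -- `W` is the same tangent vector in the model of reflections
        ∃ W : PoincareDisk.Mat A,
          HasDerivAt (fun t : ℝ => PoincareDisk.refl (PoincareDisk.geodesic z₀ X t)) W 0 ∧
          ∀ x : PoincareDisk.line z₀, PoincareDisk.IsNormalized x →
            IsStrictlyPositive (PoincareDisk.matrixOf x ψ) ∧
            0 ≤ PoincareDisk.matrixOf x (PoincareDisk.innerEnd x V V) ∧
            PoincareDisk.modulus x V = (1 / 2 : ℝ) • PoincareDisk.logEnd x ψ ∧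
            PoincareDisk.finslerNorm x V =
              1 / 2 * PoincareDisk.normEnd x (PoincareDisk.logEnd x ψ) ∧
            PoincareDisk.modulus x W = PoincareDisk.logEnd x ψ ∧
            PoincareDisk.finslerNorm x W =
              PoincareDisk.normEnd x (PoincareDisk.logEnd x ψ)) := by
  refine ⟨PoincareDisk.existsUnique_joins h₀ h₁, PoincareDisk.existsUnique_isCrossRatio h₀ h₁,
    fun X φ hX _ => PoincareDisk.existsUnique_isTransport h₀ hX φ,
    PoincareDisk.exists_isNormalized h₀, fun X φ ψ hX hφ hψ =>
      ⟨_, PoincareDisk.hasDerivAt_proj_geodesic h₀ hX.1.thetaAdj_eq, _,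
        PoincareDisk.hasDerivAt_refl_geodesic h₀ hX.1.thetaAdj_eq, fun x hx => ?_⟩⟩
  obtain ⟨hpos, hexp⟩ := PoincareDisk.matrixOf_transport_eq_exp_modulus h₀ hX hφ hψ hx
  set V := PoincareDisk.velocity z₀ X
  have hlog : PoincareDisk.logEnd x ψ = (2 : ℝ) • PoincareDisk.modulus x V :=
    PoincareDisk.logEnd_eq_smul_modulus hx hexp
  have hnorm : PoincareDisk.normEnd x (PoincareDisk.logEnd x ψ)
      = 2 * PoincareDisk.finslerNorm x V := by
    rw [hlog, PoincareDisk.normEnd_smul, abs_two,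
      PoincareDisk.finslerNorm_eq_normEnd_modulus hx hpos]
  refine ⟨?_, hpos, ?_, ?_, ?_, ?_⟩
  · rw [hexp]
    exact PoincareDisk.isStrictlyPositive_exp
      ((IsSelfAdjoint.all _).smul (PoincareDisk.isSelfAdjoint_matrixOf_modulus hx V))
  · rw [hlog, smul_smul, one_div_mul_cancel two_ne_zero, one_smul]
  · rw [hnorm, one_div, inv_mul_cancel_left₀ two_ne_zero]
  · rw [hlog, PoincareDisk.modulus_smul hx hpos zero_le_two]
  · rw [hnorm, PoincareDisk.finslerNorm_smul, abs_two]
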